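/- \textbf{Setting.} Let $\mathcal M=(S,A,p_S,(s_0,l_0),L,p_L,c_A)$ be a probabilistic labeled finite MDP: $S,A$ and the set $AP$ of atomic propositions are finite; $A(s)\neq\emptyset$ is the set of actions enabled at $s$; $p_S(s,a,\cdot)$ is a probability distribution on $S$ for $a\in A(s)$; $L(s)\subseteq 2^{AP}$ is the set of possible labels of $s$ and $p_L(s,\cdot)$ is a probability distribution on $L(s)$; $l_0\in L(s_0)$. Let $\mathcal A=(Q,2^{AP}\cup\{\epsilon\},\delta,q_0,F)$ be a limit-deterministic B\"uchi automaton with finitely many states and finitely many indexed epsilons, $\delta:Q\times(2^{AP}\cup\{\epsilon\})\to 2^Q$, in which every state $q$ has some move $\iota$ with $|\delta(q,\iota)|=1$. \textbf{Relaxed product.} $\mathcal R$ has states $X=\{(s,l,q): s\in S,\ l\in L(s),\ q\in Q\}$, initial state $x_0=(s_0,l_0,q_0)$ and accepting states $\{(s,l,q)\in X: q\in F\}$. For $x=(s,l,q)$, $x'=(s',l',q')$ and $u=(a,\iota)$, put $p^{\mathcal R}(x,u,x')=p_L(s',l')\,p_S(s,a,s')$ if $\iota\in 2^{AP}$ and $q'\in\delta(q,\iota)$;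 $p^{\mathcal R}(x,u,x')=1$ if $\iota$ is an epsilon, $q'\in\delta(q,\iota)$ and $(s',l')=(s,l)$; and $p^{\mathcal R}(x,u,x')=0$ otherwise. The set $U^{\mathcal R}(x)$ of enabled actions consists of the $(a,\iota)$ with $a\in A(s)$ and $\sum_{x'}p^{\mathcal R}(x,(a,\iota),x')=1$. The execution cost is $c_A^{\mathcal R}(x,(a,\iota))=c_A(s,a)$ if $a\in A(s)$ and $0$ otherwise. The violation cost $c_V^{\mathcal R}(x,(a,\iota),x')$ is $0$ if $\iota$ is an epsilon, and otherwise $p_L(s',l')$ times the least cardinality of a symmetric difference of $l$ with a letter $\alpha$ such that $q'\in\delta(q,\alpha)$ (taken to be $0$ if there is no such letter). An end component of $\mathcal R$ is a pair $(X',U')$ with $X'\ne\emptyset$ and $\emptyset\neq U'(x)\subseteq U^{\mathcal R}(x)$ for $x\in X'$, closed under transitions, whose induced directed graph is strongly connected; an AMEC is an end component that is maximal and contains an accepting state. Let $X_R$ be the union of the state sets of all AMECs, and $X_r$ the set of states outside $X_R$ reachable from $x_0$ (with $x_0$ reachable from itself). Let $X_n\subseteq X_r$ be the states that can reach $X_R$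 along edges of zero violation cost, and $X_{\neg n}\subseteq X_r$ the states that can reach $X_R$ but only by using edges of nonzero violation cost. Let $X_{tr},X_{tr}'\subseteq X_R$ be the sets of states of $X_R$ reachable in one transition from $X_n$, $X_{\neg n}$ respectively. \textbf{Prefix MDP.} $\mathcal R_{pre}$ has state set $X_{pre}=X_r\cup X_{tr}\cup X_{tr}'\cup\{v\}$, where $v$ is a trap state that stands for the union of the AMECs; it is assumed that $x_0\in X_{pre}$. The enabled actions are $U_{pre}^{\mathcal R}(x)=U^{\mathcal R}(x)$ for $x\ne v$ and $U_{pre}^{\mathcal R}(v)=\{\tau\}$. The transitions are $p^{\mathcal R}_{pre}(x,u,\bar x)=p^{\mathcal R}(x,u,\bar x)$ for $x\in X_r$, $\bar x\neq v$; $p^{\mathcal R}_{pre}(x,u,v)=1$ for $x\in X_{tr}\cup X_{tr}'$; $p^{\mathcal R}_{pre}(v,\tau,v)=1$; all other values are $0$. For $\beta>0$ let $c^{\mathcal R}_{pre}(x,u,\bar x)=c_{A_{pre}}(x,u)\max\{e^{\beta c_{V_{pre}}(x,u,\bar x)},1\}$, where $c_{A_{pre}}=c_A^{\mathcal R}$ for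 $x\in X_r$ and $0$ elsewhere, and $c_{V_{pre}}=c_V^{\mathcal R}$ for $x\in X_r$, $\bar x\in X_r\cup X_{tr}$ and $0$ elsewhere. \textbf{Linear program.} Let $\gamma\in(0,1]$. The variables are $y_{x,u}$ for $x\in X_r\cup X_{tr}\cup X_{tr}'$ and $u\in U^{\mathcal R}_{pre}(x)$, and $\sum_{(x,u)}$ is the sum over these pairs. Minimize $$\sum_{(x,u)}\sum_{\bar x\in X_{pre}}y_{x,u}\,p^{\mathcal R}_{pre}(x,u,\bar x)\,c^{\mathcal R}_{pre}(x,u,\bar x)$$ subject to $y_{x,u}\ge 0$ for all $(x,u)$, $$\sum_{(x,u)}\ \sum_{\bar x\in X_{tr}\cup X_{tr}'}y_{x,u}\,p^{\mathcal R}_{pre}(x,u,\bar x)\ge\gamma,\qquad \sum_{u'\in U_{pre}^{\mathcal R}(x')}y_{x',u'}=\sum_{(x,u)}y_{x,u}\,p^{\mathcal R}_{pre}(x,u,x')+\mathbf 1[x'=x_0]\quad\text{for all } x'\in X_r .$$ For an optimal solution $y^*$ let $\boldsymbol\pi^*_{pre}$ be the stationary stochastic policy of $\mathcal R_{pre}$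 with $$\boldsymbol\pi^*_{pre}(x,u)=\frac{y^*_{x,u}}{\sum_{\bar u\in U_{pre}^{\mathcal R}(x)}y^*_{x,\bar u}}\ \text{ if } x\in X_r \text{ and } \sum_{\bar u\in U_{pre}^{\mathcal R}(x)}y^*_{x,\bar u}>0,\qquad \boldsymbol\pi^*_{pre}(x,u)=\frac1{|U_{pre}^{\mathcal R}(x)|}\ \text{ otherwise,}$$ for $u\in U_{pre}^{\mathcal R}(x)$. \textbf{Lemma.} For every optimal solution $y^*$ of the linear program, the Markov chain on $X_{pre}$ induced by $\boldsymbol\pi^*_{pre}$ and started at $x_0$ reaches the trap state $v$ with probability at least $\gamma$: $\Pr^{\boldsymbol\pi^*_{pre}}_{x_0,\mathcal R_{pre}}(\lozenge v)\ge\gamma$. Likewise it visits a state that belongs to an AMEC of $\mathcal R$ with probability at least $\gamma$. -/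

import Mathlib

open MeasureTheory ProbabilityTheory

/-! ### Finite Markov decision processes, policies and path measures -/

/-- A finite MDP: every state has at least one enabled action, and every enabled action yields a
probability distribution on the successor states. -/
structure FinMDP (X U : Type*) [Fintype X] where
  enabled : X → Finset U
  enabled_nonempty : ∀ x, (enabled x).Nonempty
  p : X → U → X → ℝ
  p_nonneg : ∀ x, ∀ u ∈ enabled x, ∀ x', 0 ≤ p x u x'
  p_sum : ∀ x, ∀ u ∈ enabled x, ∑ x', p x u x' = 1
  init : X

namespace FinMDP

variable {X U : Type*} [Fintype X] (R : FinMDP X U)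

/-- Edge of the directed graph of the MDP. -/
def Edge (x x' : X) : Prop := ∃ u ∈ R.enabled x, 0 < R.p x u x'

/-- A sub-MDP `(X', U')`: a nonempty set of states with nonempty sets of enabled actions, closed
under the transitions of these actions. Only the values of `U'` on `X'` matter. -/
def IsSubMDP (X' : Set X) (U' : X → Set U) : Prop :=
  X'.Nonempty ∧ (∀ x ∈ X', (U' x).Nonempty ∧ U' x ⊆ ↑(R.enabled x)) ∧
    ∀ x ∈ X', ∀ u ∈ U' x, ∀ x', 0 < R.p x u x' → x' ∈ X'

/-- An end component: a (closed) sub-MDP whose induced graph is strongly connected. -/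
def IsEC (X' : Set X) (U' : X → Set U) : Prop :=
  R.IsSubMDP X' U' ∧ ∀ x ∈ X', ∀ x' ∈ X',
    Relation.ReflTransGen (fun z z' => z ∈ X' ∧ z' ∈ X' ∧ ∃ u ∈ U' z, 0 < R.p z u z') x x'

/-- A maximal end component: no other end component contains it. -/
def IsMEC (X' : Set X) (U' : X → Set U) : Prop :=
  R.IsEC X' U' ∧ ∀ X'' U'', R.IsEC X'' U'' → X' ⊆ X'' → (∀ x ∈ X', U' x ⊆ U'' x) →
    X'' = X' ∧ ∀ x ∈ X', U'' x = U' x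

/-- A stationary stochastic policy. -/
structure Policy where
  prob : X → U → ℝ
  nonneg : ∀ x u, 0 ≤ prob x u
  support : ∀ x, ∀ u ∉ R.enabled x, prob x u = 0
  sum_eq_one : ∀ x, ∑ u ∈ R.enabled x, prob x u = 1

variable {R}

/-- One-step transition probability of the Markov chain induced by a policy. -/
def Policy.trans (π : R.Policy) (x x' : X) : ℝ :=
  ∑ u ∈ R.enabled x, π.prob x u * R.p x u x'

theorem Policy.trans_nonneg (π : R.Policy) (x x' : X) : 0 ≤ π.trans x x' :=
  Finset.sum_nonneg fun u hu => mul_nonneg (π.nonneg x u) (R.p_nonneg x u hu x')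

theorem Policy.trans_sum (π : R.Policy) (x : X) : ∑ x', π.trans x x' = 1 := by
  unfold Policy.trans
  rw [Finset.sum_comm, ← π.sum_eq_one x]
  refine Finset.sum_congr rfl fun u hu => ?_
  rw [← Finset.mul_sum, R.p_sum x u hu, mul_one]

/-- The law of the next state. -/
noncomputable def Policy.stepPMF (π : R.Policy) (x : X) : PMF X :=
  PMF.ofFintype (fun x' => ENNReal.ofReal (π.trans x x')) (by
    rw [← ENNReal.ofReal_sum_of_nonneg fun x' _ => π.trans_nonneg x x', π.trans_sum,
      ENNReal.ofReal_one])

section PathMeasure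

variable [MeasurableSpace X] [DiscreteMeasurableSpace X]

/-- The transition kernel of the induced Markov chain. -/
noncomputable def Policy.stepKernel (π : R.Policy) : Kernel X X where
  toFun x := (π.stepPMF x).toMeasure
  measurable' := Measurable.of_discrete

instance (π : R.Policy) : IsMarkovKernel π.stepKernel :=
  ⟨fun x => (inferInstance : IsProbabilityMeasure (π.stepPMF x).toMeasure)⟩

/-- The law, on infinite state paths, of the induced Markov chain started in the initial state of
the MDP (Ionescu-Tulcea). -/
noncomputable def Policy.pathMeasure (π : R.Policy) : Measure (ℕ → X) :=
  Kernel.trajMeasure (X := fun _ => X) (Measure.dirac R.init)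
    (fun n => π.stepKernel.comap (fun h : (i : Finset.Iic n) → X => h ⟨n, Finset.mem_Iic.2 le_rfl⟩)
      (measurable_pi_apply _))

instance (π : R.Policy) : IsProbabilityMeasure π.pathMeasure := by
  unfold Policy.pathMeasure; infer_instance

end PathMeasure

end FinMDP

/-! ### Labeled MDPs, automata and the relaxed product -/

/-- A probabilistic labeled finite MDP. `L s` is the set of labels that can occur at `s`, and
`pL s l` is the probability of the label `l ∈ L s`. -/
structure PLMDP (S A AP : Type*) [Fintype S] where
  act : S → Finset A
  act_nonempty : ∀ s, (act s).Nonempty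
  pS : S → A → S → ℝ
  pS_nonneg : ∀ s, ∀ a ∈ act s, ∀ s', 0 ≤ pS s a s'
  pS_sum : ∀ s, ∀ a ∈ act s, ∑ s', pS s a s' = 1
  L : S → Finset (Set AP)
  pL : S → Set AP → ℝ
  pL_nonneg : ∀ s, ∀ l ∈ L s, 0 ≤ pL s l
  pL_sum : ∀ s, ∑ l ∈ L s, pL s l = 1
  s0 : S
  l0 : Set AP
  l0_mem : l0 ∈ L s0
  cA : S → A → ℝ

/-- A limit-deterministic Büchi automaton over the alphabet `2^AP`, with epsilons indexed by `E`.
The nondeterministic set of states is the complement of `QD`. -/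
structure LDBA (AP Q E : Type*) where
  δ : Q → Set AP ⊕ E → Set Q
  q0 : Q
  F : Set Q
  QD : Set Q
  det : ∀ q ∈ QD, ∀ α : Set AP, ∃ q' ∈ QD, δ q (Sum.inl α) = {q'}
  eps_subsingleton : ∀ q (e : E), (δ q (Sum.inr e)).Subsingleton
  eps_into : ∀ q (e : E), δ q (Sum.inr e) ⊆ QD
  eps_det : ∀ q ∈ QD, ∀ e : E, δ q (Sum.inr e) = ∅
  F_subset : F ⊆ QD

/-- Every automaton state has an unambiguous move (automatic on `QD`). -/
def LDBA.Nonblocking {AP Q E : Type*} (B : LDBA AP Q E) : Prop := ∀ q, ∃ ι q', B.δ q ι = {q'}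

/-- An MDP with accepting states, an execution cost and a violation cost. -/
structure CostMDP (X U : Type*) [Fintype X] extends FinMDP X U where
  Acc : Set X
  cA : X → U → ℝ
  cV : X → U → X → ℝ

section Product

variable {S A AP Q E : Type*} [Fintype S] [Fintype AP] [Fintype Q]

/-- The labeled states `(s, l, q)` with `l ∈ L s`. -/
def ProdState (M : PLMDP S A AP) (Q : Type*) : Type _ := {x : S × Set AP × Q // x.2.1 ∈ M.L x.1}

noncomputable instance (M : PLMDP S A AP) : Fintype (ProdState M Q) := by
  classical
  exact inferInstanceAs (Fintype {x : S × Set AP × Q // x.2.1 ∈ M.L x.1})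

variable {M : PLMDP S A AP}

def ProdState.s (x : ProdState M Q) : S := x.1.1

def ProdState.l (x : ProdState M Q) : Set AP := x.1.2.1

def ProdState.q (x : ProdState M Q) : Q := x.1.2.2

variable (M)

theorem sum_prodState (f : S → Set AP → Q → ℝ) :
    ∑ x : ProdState M Q, f x.s x.l x.q = ∑ s, ∑ l ∈ M.L s, ∑ q, f s l q := by
  classical
  have h1 : ∑ x : ProdState M Q, f x.s x.l x.q =
      ∑ x ∈ (Finset.univ : Finset (S × Set AP × Q)).filter (fun x => x.2.1 ∈ M.L x.1),
        f x.1 x.2.1 x.2.2 := by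
    refine Finset.sum_bij (fun x _ => x.1) (fun x _ => by simpa using x.2)
      (fun x _ y _ h => Subtype.ext h)
      (fun x hx => ⟨⟨x, (Finset.mem_filter.1 hx).2⟩, Finset.mem_univ _, rfl⟩) (fun x _ => rfl)
  rw [h1, Finset.sum_filter, Fintype.sum_prod_type]
  refine Finset.sum_congr rfl fun s _ => ?_
  rw [Fintype.sum_prod_type, ← Finset.sum_filter_add_sum_filter_not Finset.univ (· ∈ M.L s)]
  have h2 : ∑ l ∈ Finset.univ.filter (fun l => ¬ l ∈ M.L s),
      ∑ q : Q, (if l ∈ M.L s then f s l q else 0) = 0 :=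
    Finset.sum_eq_zero fun l hl => by simp [(Finset.mem_filter.1 hl).2]
  rw [h2, add_zero]
  have h3 : Finset.univ.filter (· ∈ M.L s) = M.L s := by ext; simp
  rw [h3]
  exact Finset.sum_congr rfl fun l hl => by simp [hl]

variable [Fintype A] [Fintype E] (B : LDBA AP Q E)

open scoped Classical in
/-- Transition function of the relaxed product: the automaton component reads the letter `ι` chosen
by the agent, not necessarily the current label. -/
noncomputable def relaxedP (x : ProdState M Q) (u : A × (Set AP ⊕ E)) (x' : ProdState M Q) : ℝ :=
  match u with
  | (a, Sum.inl α) =>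
      if x'.q ∈ B.δ x.q (Sum.inl α) then M.pL x'.s x'.l * M.pS x.s a x'.s else 0
  | (_, Sum.inr e) =>
      if x'.q ∈ B.δ x.q (Sum.inr e) ∧ x'.s = x.s ∧ x'.l = x.l then 1 else 0

open scoped Classical in
/-- The enabled actions: pairs `(a, ι)` with `a` enabled in `M` under which the transition function
is a probability distribution. -/
noncomputable def relaxedEnabled (x : ProdState M Q) : Finset (A × (Set AP ⊕ E)) :=
  Finset.univ.filter fun u => u.1 ∈ M.act x.s ∧ ∑ x', relaxedP M B x u x' = 1

/-- Distance from a label to a set of labels: the least size of a symmetric difference. -/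
noncomputable def labelDist (l : Set AP) (χ : Set (Set AP)) : ℕ :=
  sInf ((fun l' => (symmDiff l l').ncard) '' χ)

/-- `w_V (x, x')`: distance from the label of `x` to the letters enabling `q → q'`. -/
noncomputable def violationWeight (x x' : ProdState M Q) : ℝ :=
  labelDist x.l {α | x'.q ∈ B.δ x.q (Sum.inl α)}

theorem relaxedEnabled_nonempty (hB : B.Nonblocking) (x : ProdState M Q) :
    (relaxedEnabled M B x).Nonempty := by
  classical
  obtain ⟨ι, q', hι⟩ := hB x.q
  obtain ⟨a, ha⟩ := M.act_nonempty x.s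
  refine ⟨(a, ι), Finset.mem_filter.2 ⟨Finset.mem_univ _, ha, ?_⟩⟩
  cases ι with
  | inl α =>
    simp only [relaxedP, hι, Set.mem_singleton_iff]
    rw [sum_prodState M (fun s l q => if q = q' then M.pL s l * M.pS x.s a s else 0)]
    simp only [Finset.sum_ite_eq', Finset.mem_univ, if_true, ← Finset.sum_mul, M.pL_sum, one_mul]
    exact M.pS_sum x.s a ha
  | inr e =>
    simp only [relaxedP, hι, Set.mem_singleton_iff]
    refine (Finset.sum_eq_single (⟨(x.s, x.l, q'), x.2⟩ : ProdState M Q) ?_ ?_).trans ?_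
    · rintro z - hz
      refine if_neg fun h => hz ?_
      exact Subtype.ext (Prod.ext h.2.1 (Prod.ext h.2.2 h.1))
    · intro h; exact absurd (Finset.mem_univ _) h
    · exact if_pos ⟨rfl, rfl, rfl⟩

open scoped Classical in
/-- The relaxed product MDP of a labeled MDP and an LDBA. -/
noncomputable def relaxedProduct (hB : B.Nonblocking) :
    CostMDP (ProdState M Q) (A × (Set AP ⊕ E)) where
  enabled := relaxedEnabled M B
  enabled_nonempty := relaxedEnabled_nonempty M B hB
  p := relaxedP M B
  p_nonneg := by
    rintro x ⟨a, ι⟩ hu x'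
    have ha := (Finset.mem_filter.1 hu).2.1
    cases ι <;> simp only [relaxedP] <;> split_ifs
    · exact mul_nonneg (M.pL_nonneg _ _ x'.2) (M.pS_nonneg _ _ ha _)
    all_goals norm_num
  p_sum := fun x u hu => (Finset.mem_filter.1 hu).2.2
  init := ⟨(M.s0, M.l0, B.q0), M.l0_mem⟩
  Acc := {x | x.q ∈ B.F}
  cA x u := if u.1 ∈ M.act x.s then M.cA x.s u.1 else 0
  cV x u x' :=
    match u.2 with
    | Sum.inl _ => M.pL x'.s x'.l * violationWeight M B x x'
    | Sum.inr _ => 0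

end Product

/-! ### State partition, prefix MDP, linear program and prefix policy -/

namespace CostMDP

variable {X U : Type*} [Fintype X] (R : CostMDP X U)

/-- An accepting maximal end component. -/
def IsAMEC (X' : Set X) (U' : X → Set U) : Prop := R.IsMEC X' U' ∧ (X' ∩ R.Acc).Nonempty

/-- `X_R`: the union of the state sets of the AMECs. -/
def amecStates : Set X := {x | ∃ X' U', R.IsAMEC X' U' ∧ x ∈ X'}

/-- `X_r`: the states outside `X_R` that are reachable from the initial state. -/
def Xr : Set X := {x | x ∉ R.amecStates ∧ Relation.ReflTransGen R.Edge R.init x}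

/-- `X_n`: the states of `X_r` that can reach `X_R` through edges without violation cost. -/
def Xn : Set X := {x | x ∈ R.Xr ∧ ∃ x' ∈ R.amecStates,
  Relation.ReflTransGen (fun z z' => ∃ u ∈ R.enabled z, 0 < R.p z u z' ∧ R.cV z u z' = 0) x x'}

/-- `X_¬n`: the states of `X_r` that can reach `X_R`, but only with violation edges. -/
def Xnn : Set X := {x | x ∈ R.Xr ∧ x ∉ R.Xn ∧ ∃ x' ∈ R.amecStates,
  Relation.ReflTransGen R.Edge x x'}

/-- `X_tr`: the states of `X_R` reached within one transition from `X_n`. -/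
def Xtr : Set X := {x' | x' ∈ R.amecStates ∧ ∃ x ∈ R.Xn, R.Edge x x'}

/-- `X_tr'`: the states of `X_R` reached within one transition from `X_¬n`. -/
def Xtr' : Set X := {x' | x' ∈ R.amecStates ∧ ∃ x ∈ R.Xnn, R.Edge x x'}

/-- `X_r ∪ X_tr ∪ X_tr'`. -/
def prefixCore : Set X := R.Xr ∪ (R.Xtr ∪ R.Xtr')

/-- `X_pre`: the set `X_r ∪ X_tr ∪ X_tr'` together with the trap state `none`. -/
def PrefixState : Type _ := Option R.prefixCore

noncomputable instance : Fintype R.PrefixState := by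
  classical
  exact inferInstanceAs (Fintype (Option R.prefixCore))

instance : MeasurableSpace R.PrefixState := ⊤

instance : DiscreteMeasurableSpace R.PrefixState := ⟨fun _ => trivial⟩

/-- The trap state `v`. -/
def trap : R.PrefixState := (none : Option R.prefixCore)

/-- Embedding of `X_r ∪ X_tr ∪ X_tr'` into `X_pre`. -/
def toPrefix (x : R.prefixCore) : R.PrefixState := (some x : Option R.prefixCore)

/-- The states of `X_pre` lying in a given set of states of `R`. -/
def inPrefix (Y : Set X) : Set R.PrefixState := {z | ∃ x : R.prefixCore, z = R.toPrefix x ∧ x.1 ∈ Y}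

/-- Actions of the prefix MDP: those of `R`, and the self-loop action `none` (denoted `τ`) at `v`. -/
def prefixEnabled : R.PrefixState → Finset (Option U)
  | some x => (R.enabled x.1).map Function.Embedding.some
  | none => {none}

open scoped Classical in
/-- Transition function of the prefix MDP. -/
noncomputable def prefixP : R.PrefixState → Option U → R.PrefixState → ℝ
  | some x, some u, some x' => if x.1 ∈ R.Xr then R.p x.1 u x'.1 else 0
  | some x, some _, none => if x.1 ∈ R.Xtr ∪ R.Xtr' then 1 else 0
  | none, none, none => 1
  | _, _, _ => 0

open scoped Classical in
/-- Execution cost of the prefix MDP. -/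
noncomputable def prefixCA : R.PrefixState → Option U → ℝ
  | some x, some u => if x.1 ∈ R.Xr then R.cA x.1 u else 0
  | _, _ => 0

open scoped Classical in
/-- Violation cost of the prefix MDP. -/
noncomputable def prefixCV : R.PrefixState → Option U → R.PrefixState → ℝ
  | some x, some u, some x' =>
      if x.1 ∈ R.Xr ∧ x'.1 ∈ R.Xr ∪ R.Xtr then R.cV x.1 u x'.1 else 0
  | _, _, _ => 0

/-- Regulation cost of a transition of the prefix MDP. -/
noncomputable def prefixCost (β : ℝ) (x : R.PrefixState) (u : Option U) (x' : R.PrefixState) : ℝ :=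
  R.prefixCA x u * max (Real.exp (β * R.prefixCV x u x')) 1

theorem Xtr_union_disjoint {x : X} (h : x ∈ R.Xr) : x ∉ R.Xtr ∪ R.Xtr' := by
  rintro (h' | h')
  · exact h.1 h'.1
  · exact h.1 h'.1

theorem prefixCore_succ {x x' : X} (hx : x ∈ R.Xr) (h : R.Edge x x') : x' ∈ R.prefixCore := by
  classical
  by_cases hR : x' ∈ R.amecStates
  · right
    by_cases hn : x ∈ R.Xn
    · exact Or.inl ⟨hR, x, hn, h⟩
    · exact Or.inr ⟨hR, x, ⟨hx, hn, x', hR, .single h⟩, h⟩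
  · exact Or.inl ⟨hR, hx.2.tail h⟩

theorem prefixP_sum (z : R.PrefixState) (u : Option U) (hu : u ∈ R.prefixEnabled z) :
    ∑ z', R.prefixP z u z' = 1 := by
  classical
  have key : ∀ f : Option R.prefixCore → ℝ,
      ∑ z' : R.PrefixState, f z' = f none + ∑ x : R.prefixCore, f (some x) := by
    intro f
    rw [← Fintype.sum_option f]
    exact Finset.sum_congr
      (Finset.ext fun _ => iff_of_true (Finset.mem_univ _) (Finset.mem_univ _)) fun _ _ => rfl
  refine (key fun z' => R.prefixP z u z').trans ?_
  match z, hu with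
  | none, hu =>
    obtain rfl : u = none := Finset.mem_singleton.1 hu
    simp [prefixP]
  | some x, hu =>
    obtain ⟨u, hu', rfl⟩ := Finset.mem_map.1 hu
    simp only [prefixP, Function.Embedding.some_apply]
    by_cases hx : x.1 ∈ R.Xr
    · simp only [if_neg (R.Xtr_union_disjoint hx), if_pos hx, zero_add]
      rw [← R.p_sum x.1 u hu']
      have h1 : ∑ x' : X, R.p x.1 u x' =
          ∑ x' ∈ Finset.univ.filter (· ∈ R.prefixCore), R.p x.1 u x' := by
        symm
        refine Finset.sum_subset (Finset.subset_univ _) fun x' _ hx' => ?_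
        by_contra h0
        refine hx' (Finset.mem_filter.2 ⟨Finset.mem_univ _, R.prefixCore_succ hx ⟨u, hu', ?_⟩⟩)
        exact lt_of_le_of_ne (R.p_nonneg _ _ hu' _) (Ne.symm h0)
      rw [h1]
      exact (Finset.sum_subtype (p := fun x' => x' ∈ R.prefixCore) _ (by simp) _).symm
    · simp only [if_pos (x.2.resolve_left hx), if_neg hx, Finset.sum_const_zero, add_zero]

/-- The prefix MDP of `R`; it is defined when the initial state belongs to `X_pre`. -/
noncomputable def prefixMDP (h0 : R.init ∈ R.prefixCore) : FinMDP R.PrefixState (Option U) where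
  enabled := R.prefixEnabled
  enabled_nonempty := by
    rintro (_ | x)
    · exact Finset.singleton_nonempty _
    · exact (R.enabled_nonempty x.1).map
  p := R.prefixP
  p_nonneg := by
    rintro (_ | x) u hu (_ | x')
    · obtain rfl : u = none := Finset.mem_singleton.1 hu
      simp [prefixP]
    · obtain rfl : u = none := Finset.mem_singleton.1 hu
      simp [prefixP]
    · obtain ⟨u, hu', rfl⟩ := Finset.mem_map.1 hu
      simp only [prefixP, Function.Embedding.some_apply]
      split_ifs <;> norm_num
    · obtain ⟨u, hu', rfl⟩ := Finset.mem_map.1 hu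
      simp only [prefixP, Function.Embedding.some_apply]
      split_ifs
      · exact R.p_nonneg x.1 u hu' _
      · exact le_rfl
  p_sum := R.prefixP_sum
  init := R.toPrefix ⟨R.init, h0⟩

open scoped Classical in
/-- The states `X_r ∪ X_tr ∪ X_tr'` over which the sums of the linear program run. -/
noncomputable def lpStates : Finset R.PrefixState :=
  Finset.univ.filter fun z => z ≠ R.trap

/-- The objective `J_pre` of the linear program. -/
noncomputable def lpObjective (β : ℝ) (y : R.PrefixState → Option U → ℝ) : ℝ :=
  ∑ x ∈ R.lpStates, ∑ u ∈ R.prefixEnabled x, ∑ x',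
    y x u * R.prefixP x u x' * R.prefixCost β x u x'

open scoped Classical in
/-- Feasibility for the linear program with threshold `γ`. Only the values `y x u` with
`x ∈ X_r ∪ X_tr ∪ X_tr'` and `u` enabled at `x` matter. -/
structure LPFeasible (γ : ℝ) (y : R.PrefixState → Option U → ℝ) : Prop where
  nonneg : ∀ x ∈ R.lpStates, ∀ u ∈ R.prefixEnabled x, 0 ≤ y x u
  reach : γ ≤ ∑ x ∈ R.lpStates, ∑ u ∈ R.prefixEnabled x,
    ∑ x' ∈ Finset.univ.filter (· ∈ R.inPrefix (R.Xtr ∪ R.Xtr')), y x u * R.prefixP x u x'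
  flow : ∀ x' ∈ R.inPrefix R.Xr, ∑ u' ∈ R.prefixEnabled x', y x' u' =
    (∑ x ∈ R.lpStates, ∑ u ∈ R.prefixEnabled x, y x u * R.prefixP x u x') +
      if x' ∈ R.inPrefix {R.init} then 1 else 0

/-- Optimal solutions of the linear program. -/
structure LPOptimal (β γ : ℝ) (y : R.PrefixState → Option U → ℝ) : Prop where
  feasible : R.LPFeasible γ y
  minimal : ∀ y', R.LPFeasible γ y' → R.lpObjective β y ≤ R.lpObjective β y'

open scoped Classical in
/-- The formula of the prefix policy: normalize `y` on the states of `X_r` with positive total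
weight, choose uniformly among the enabled actions elsewhere. -/
noncomputable def prefixPolicyProb (y : R.PrefixState → Option U → ℝ)
    (x : R.PrefixState) (u : Option U) : ℝ :=
  if u ∈ R.prefixEnabled x then
    if x ∈ R.inPrefix R.Xr ∧ 0 < ∑ w ∈ R.prefixEnabled x, y x w then
      y x u / ∑ w ∈ R.prefixEnabled x, y x w
    else 1 / ((R.prefixEnabled x).card : ℝ)
  else 0

/-- The prefix policy obtained from a feasible `y`, as a stationary policy of the prefix MDP. -/
noncomputable def prefixPolicy (h0 : R.init ∈ R.prefixCore) {γ : ℝ}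
    {y : R.PrefixState → Option U → ℝ} (hy : R.LPFeasible γ y) : (R.prefixMDP h0).Policy where
  prob := R.prefixPolicyProb y
  nonneg := by
    classical
    intro x u
    unfold prefixPolicyProb
    split_ifs with h1 h2
    · refine div_nonneg (hy.nonneg x ?_ u h1) h2.2.le
      obtain ⟨⟨x', rfl, -⟩, -⟩ := h2
      exact Finset.mem_filter.2 ⟨Finset.mem_univ _, Option.some_ne_none _⟩
    · positivity
    · exact le_rfl
  support := fun x u hu => if_neg hu
  sum_eq_one := by
    intro x
    have hne : (R.prefixEnabled x).Nonempty := (R.prefixMDP h0).enabled_nonempty x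
    change ∑ u ∈ R.prefixEnabled x, R.prefixPolicyProb y x u = 1
    by_cases h : x ∈ R.inPrefix R.Xr ∧ 0 < ∑ w ∈ R.prefixEnabled x, y x w
    · rw [Finset.sum_congr rfl (g := fun u => y x u / ∑ w ∈ R.prefixEnabled x, y x w)
        fun u hu => by simp only [prefixPolicyProb, if_pos hu, if_pos h]]
      rw [← Finset.sum_div, div_self h.2.ne']
    · rw [Finset.sum_congr rfl (g := fun _ => 1 / ((R.prefixEnabled x).card : ℝ))
        fun u hu => by simp only [prefixPolicyProb, if_pos hu, if_neg h]]
      have : ((R.prefixEnabled x).card : ℝ) ≠ 0 := by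
        exact_mod_cast hne.card_pos.ne'
      rw [Finset.sum_const, nsmul_eq_mul, mul_one_div_cancel this]

end CostMDP

/-! The flow constraints force both events to have probability 1, and `γ ≤ 1` concludes. Put `μ(z) =
∑ u, y z u` for `z` in `X_r`. Normalizing `y` makes the flow of the induced chain out of each state
of `X_r` at most the flow prescribed by `y`, so `μ` is a finite nonnegative supersolution of the
balance equations for the expected numbers of visits. The chain cannot return to `X_r` once it has
left, so an induction on time bounds the expected visits to each state of `X_r` by `μ`. By
Borel–Cantelli each of these finitely many states is almost surely visited only finitely often,
hence the chain leaves `X_r` (`Policy.ae_exists_notMem`, `mul_prefixPolicy_trans_le`).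

The trap has no incoming edge from `X_r` and is not the initial state, so the first state outside
`X_r` lies in `X_tr` or `X_tr'`, thus in an AMEC, and its only successor is the trap
(`ae_exists_amecStates_and_trap`). -/

namespace FinMDP

variable {X U : Type*} [Fintype X] {R : FinMDP X U}

/-! ### Path measures of finite Markov chains and almost sure exit from a set -/

section PathMeasure

variable [MeasurableSpace X] [DiscreteMeasurableSpace X]

theorem Policy.stepKernel_singleton (π : R.Policy) (x x' : X) :
    π.stepKernel x {x'} = ENNReal.ofReal (π.trans x x') := by
  change (π.stepPMF x).toMeasure {x'} = _
  rw [PMF.toMeasure_apply_singleton _ _ (MeasurableSet.singleton x')]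
  rfl

/-- The induced chain starts in the initial state of the MDP. -/
theorem Policy.ae_eval_zero (π : R.Policy) : ∀ᵐ ω ∂π.pathMeasure, ω 0 = R.init := by
  have hfr := Preorder.measurable_frestrictLe (X := fun _ : ℕ => X) 0
  let C : Set ((i : Finset.Iic 0) → X) := {h | h ⟨0, Finset.mem_Iic.2 le_rfl⟩ ≠ R.init}
  have hC : MeasurableSet C :=
    (MeasurableSet.singleton R.init).compl.preimage
      (measurable_pi_apply (⟨0, Finset.mem_Iic.2 le_rfl⟩ : Finset.Iic 0))
  rw [ae_iff]
  change π.pathMeasure (Preorder.frestrictLe (π := fun _ : ℕ => X) 0 ⁻¹' C) = 0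
  -- The marginal on coordinates up to 0 involves no transition: it is the Dirac mass at `R.init`,
  -- transported to functions on a one-point index set.
  rw [← Measure.map_apply hfr hC, Policy.pathMeasure, Kernel.trajMeasure,
    Measure.map_comp _ _ hfr, Kernel.traj_map_frestrictLe, Kernel.partialTraj_self,
    Measure.id_comp, Measure.map_apply (by fun_prop) hC]
  rw [Measure.dirac_apply' _ ((MeasurableEquiv.piUnique _).symm.measurable hC)]
  exact Set.indicator_of_notMem (not_not.2 rfl : _ ∉ (MeasurableEquiv.piUnique _).symm ⁻¹' C) _

/-- The joint law of two consecutive states. -/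
theorem Policy.pathMeasure_step (π : R.Policy) (n : ℕ) (x x' : X) :
    π.pathMeasure {ω | ω n = x ∧ ω (n + 1) = x'} =
      π.pathMeasure {ω | ω n = x} * ENNReal.ofReal (π.trans x x') := by
  have hfr := Preorder.measurable_frestrictLe (X := fun _ : ℕ => X) n
  let C : Set ((i : Finset.Iic n) → X) := {h | h ⟨n, Finset.mem_Iic.2 le_rfl⟩ = x}
  have hC : MeasurableSet C :=
    (MeasurableSet.singleton x).preimage
      (measurable_pi_apply (⟨n, Finset.mem_Iic.2 le_rfl⟩ : Finset.Iic n))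
  have hD : MeasurableSet ({x'} : Set X) := MeasurableSet.singleton x'
  -- The history up to `n` and the next state have joint law "history law ⊗ kernel". On the
  -- rectangle `C ×ˢ {x'}` the integrand is constant, since the kernel sees only the last
  -- coordinate, which `C` fixes to be `x`.
  have key := congrArg (fun m => m (C ×ˢ ({x'} : Set X)))
    (Kernel.map_frestrictLe_trajMeasure_compProd_eq_map_trajMeasure (X := fun _ => X)
      (μ₀ := Measure.dirac R.init)
      (κ := fun n => π.stepKernel.comap
        (fun h : (i : Finset.Iic n) → X => h ⟨n, Finset.mem_Iic.2 le_rfl⟩)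
        (measurable_pi_apply _)) (a := n))
  rw [Measure.map_apply (by fun_prop) (hC.prod hD), Measure.compProd_apply_prod hC hD] at key
  refine Eq.trans ?_ (key.symm.trans ?_)
  · rfl
  · rw [setLIntegral_congr_fun (g := fun _ => ENNReal.ofReal (π.trans x x')) hC]
    · rw [setLIntegral_const, Measure.map_apply hfr hC, mul_comm]
      rfl
    · intro h hh
      change π.stepKernel (h ⟨n, _⟩) {x'} = _
      rw [show h ⟨n, _⟩ = x from hh, π.stepKernel_singleton]

/-- Almost surely, all transitions along a path have positive probability. -/
theorem Policy.ae_trans_pos (π : R.Policy) :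
    ∀ᵐ ω ∂π.pathMeasure, ∀ n, 0 < π.trans (ω n) (ω (n + 1)) := by
  refine ae_all_iff.2 fun n => ?_
  -- Fixing the pair of states first leaves finitely many null events to discard.
  have h : ∀ x x' : X, ∀ᵐ ω ∂π.pathMeasure,
      π.trans x x' ≤ 0 → ¬ (ω n = x ∧ ω (n + 1) = x') := by
    intro x x'
    by_cases h0 : π.trans x x' ≤ 0
    · have : π.pathMeasure {ω | ω n = x ∧ ω (n + 1) = x'} = 0 := by
        rw [π.pathMeasure_step, ENNReal.ofReal_of_nonpos h0, mul_zero]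
      filter_upwards [measure_eq_zero_iff_ae_notMem.1 this] with ω hω _ using hω
    · exact .of_forall fun ω h1 => absurd h1 h0
  filter_upwards [ae_all_iff.2 fun x => ae_all_iff.2 (h x)] with ω hω
  exact not_le.1 fun hle => hω _ _ hle ⟨rfl, rfl⟩

/-- The Chapman–Kolmogorov equation for one step. -/
theorem Policy.pathMeasure_succ (π : R.Policy) (n : ℕ) (x' : X) :
    π.pathMeasure {ω | ω (n + 1) = x'} =
      ∑ x, π.pathMeasure {ω | ω n = x} * ENNReal.ofReal (π.trans x x') := by
  have hm : ∀ k (x : X), MeasurableSet {ω : ℕ → X | ω k = x} := fun k x =>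
    (MeasurableSet.singleton x).preimage (measurable_pi_apply k)
  simp only [← π.pathMeasure_step]
  rw [← measure_biUnion_finset]
  · congr 1
    ext ω
    simp
  · intro a _ b _ hab
    exact Set.disjoint_left.2 fun ω h1 h2 => hab (h1.1.symm.trans h2.1)
  · exact fun x _ => (hm n x).inter (hm (n + 1) x')

open scoped Classical in
/-- If `Y` cannot be re-entered and the balance inequalities of the expected number of visits to
the states of `Y` have a finite nonnegative solution, then the chain almost surely leaves `Y`. -/
theorem Policy.ae_exists_notMem (π : R.Policy) (Y : Set X)
    (hY : ∀ x ∉ Y, ∀ x' ∈ Y, π.trans x x' = 0) (μ : X → ℝ) (hμ : ∀ x ∈ Y, 0 ≤ μ x)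
    (hbal : ∀ x' ∈ Y, (∑ x with x ∈ Y, μ x * π.trans x x') + (if x' = R.init then 1 else 0) ≤ μ x') :
    ∀ᵐ ω ∂π.pathMeasure, ∃ n, ω n ∉ Y := by
  have hzero : ∀ x', π.pathMeasure {ω | ω 0 = x'} ≤
      ENNReal.ofReal (if x' = R.init then 1 else 0) := by
    intro x'
    split_ifs with h
    · simpa using prob_le_one
    · rw [ENNReal.ofReal_zero, nonpos_iff_eq_zero, measure_eq_zero_iff_ae_notMem]
      filter_upwards [π.ae_eval_zero] with ω hω hx using h (hx.symm.trans hω)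
  -- As `Y` cannot be re-entered, the recursion for the marginals closes on `Y`, and values of `μ`
  -- outside `Y` play no role.
  have hsucc : ∀ n, ∀ x' ∈ Y, π.pathMeasure {ω | ω (n + 1) = x'} =
      ∑ x with x ∈ Y, π.pathMeasure {ω | ω n = x} * ENNReal.ofReal (π.trans x x') := by
    intro n x' hx'
    rw [π.pathMeasure_succ, Finset.sum_filter]
    refine Finset.sum_congr rfl fun x _ => ?_
    split_ifs with hx
    · rfl
    · rw [hY x hx x' hx', ENNReal.ofReal_zero, mul_zero]
  -- The sum is the expected number of visits before time `n`. In the induction the term at time 0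
  -- is split off, not the last one: the remaining visits are one step after visits before time `n`,
  -- to which the induction hypothesis and then `hbal` apply.
  have hpartial : ∀ n, ∀ x' ∈ Y,
      ∑ k ∈ Finset.range n, π.pathMeasure {ω | ω k = x'} ≤ ENNReal.ofReal (μ x') := by
    intro n
    induction n with
    | zero => simp
    | succ n ih =>
      intro x' hx'
      have hnn : ∀ x ∈ Finset.univ.filter (· ∈ Y), 0 ≤ μ x * π.trans x x' := fun x hx =>
        mul_nonneg (hμ x (Finset.mem_filter.1 hx).2) (π.trans_nonneg x x')
      rw [Finset.sum_range_succ', Finset.sum_congr rfl fun k _ => hsucc k x' hx', Finset.sum_comm]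
      refine le_trans (add_le_add (Finset.sum_le_sum
          (g := fun x => ENNReal.ofReal (μ x * π.trans x x')) fun x hx => ?_) (hzero x'))
        (le_trans (le_of_eq ?_) (ENNReal.ofReal_le_ofReal (hbal x' hx')))
      · rw [← Finset.sum_mul, ENNReal.ofReal_mul (hμ x (Finset.mem_filter.1 hx).2)]
        gcongr
        exact ih x (Finset.mem_filter.1 hx).2
      · rw [ENNReal.ofReal_add (Finset.sum_nonneg hnn) (by split_ifs <;> norm_num),
          ENNReal.ofReal_sum_of_nonneg hnn]
  have hsum : ∀ x' ∈ Y, ∑' k, π.pathMeasure {ω | ω k = x'} ≠ ⊤ := fun x' hx' =>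
    ne_top_of_le_ne_top ENNReal.ofReal_ne_top
      (ENNReal.tsum_le_of_sum_range_le fun n => hpartial n x' hx')
  -- First Borel–Cantelli lemma, which needs no independence.
  have hev : ∀ x' ∈ Y, ∀ᵐ ω ∂π.pathMeasure, ∀ᶠ n in Filter.atTop, ω n ≠ x' := fun x' hx' =>
    ae_eventually_notMem (hsum x' hx')
  have hall : ∀ᵐ ω ∂π.pathMeasure, ∀ x', x' ∈ Y → ∀ᶠ n in Filter.atTop, ω n ≠ x' :=
    ae_all_iff.2 fun x' => by
      by_cases hx' : x' ∈ Y
      · filter_upwards [hev x' hx'] with ω hω _ using hω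
      · exact .of_forall fun _ h => absurd h hx'
  filter_upwards [hall] with ω hω
  -- Finiteness of the state space gives one time that works for all states of `Y`.
  have hfin : ∀ᶠ n in Filter.atTop, ∀ x', x' ∈ Y → ω n ≠ x' :=
    Filter.eventually_all.2 fun x' => by
      by_cases hx' : x' ∈ Y
      · filter_upwards [hω x' hx'] with n hn _ using hn
      · exact .of_forall fun _ h => absurd h hx'
  obtain ⟨n, hn⟩ := hfin.exists
  exact ⟨n, fun h => hn _ h rfl⟩

end PathMeasure

end FinMDP

/-! ### The prefix MDP: flow of the linear program and the exit from `X_r` -/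

namespace CostMDP

variable {X U : Type*} [Fintype X] (R : CostMDP X U)

theorem trap_notMem_inPrefix (Y : Set X) : R.trap ∉ R.inPrefix Y := by
  rintro ⟨x, h, -⟩
  exact Option.some_ne_none _ h.symm

theorem mem_lpStates_of_mem_inPrefix {Y : Set X} {z : R.PrefixState} (hz : z ∈ R.inPrefix Y) :
    z ∈ R.lpStates := by
  classical
  refine Finset.mem_filter.2 ⟨Finset.mem_univ _, ?_⟩
  rintro rfl
  exact R.trap_notMem_inPrefix _ hz

/-- Outside `X_r`, every transition leads to the trap state. -/
theorem prefixP_eq_zero_of_notMem_Xr {z : R.PrefixState} (hz : z ∉ R.inPrefix R.Xr)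
    (u : Option U) {z' : R.PrefixState} (hz' : z' ≠ R.trap) : R.prefixP z u z' = 0 := by
  match z, u, z' with
  | some x, some u, some x' => exact if_neg fun h => hz ⟨x, rfl, h⟩
  | some x, some u, none => exact absurd rfl hz'
  | none, none, none => exact absurd rfl hz'
  | some _, none, _ => rfl
  | none, some _, _ => rfl
  | none, none, some _ => rfl

/-- The trap state is not entered directly from `X_r`. -/
theorem prefixP_trap_eq_zero {z : R.PrefixState} (hz : z ∈ R.inPrefix R.Xr) (u : Option U) :
    R.prefixP z u R.trap = 0 := by
  obtain ⟨x, rfl, hx⟩ := hz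
  cases u with
  | none => rfl
  | some u => exact if_neg (R.Xtr_union_disjoint hx)

/-- Both `X_tr` and `X_tr'` lie in `X_R` by definition, so a path that leaves `X_r` without being at
the trap has hit an AMEC. -/
theorem prefixCore_mem_amecStates {x : X} (hx : x ∈ R.prefixCore) (h : x ∉ R.Xr) :
    x ∈ R.amecStates := by
  rcases hx.resolve_left h with h | h <;> exact h.1

variable (h0 : R.init ∈ R.prefixCore)

/-- Serves twice: it shows that `X_r` cannot be re-entered, and that the state after the exit from
`X_r` is the trap. -/
theorem trans_eq_zero_of_notMem_Xr (π : (R.prefixMDP h0).Policy) {z z' : R.PrefixState}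
    (hz : z ∉ R.inPrefix R.Xr) (hz' : z' ≠ R.trap) : π.trans z z' = 0 :=
  Finset.sum_eq_zero fun u _ =>
    mul_eq_zero_of_right _ (R.prefixP_eq_zero_of_notMem_Xr hz u hz')

theorem trans_trap_eq_zero (π : (R.prefixMDP h0).Policy) {z : R.PrefixState}
    (hz : z ∈ R.inPrefix R.Xr) : π.trans z R.trap = 0 :=
  Finset.sum_eq_zero fun u _ => mul_eq_zero_of_right _ (R.prefixP_trap_eq_zero hz u)

/-- Under the prefix policy of a feasible `y`, the flow through a state of `X_r` is at most the
flow prescribed by `y`. -/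
theorem mul_prefixPolicy_trans_le {γ : ℝ} {y : R.PrefixState → Option U → ℝ}
    (hy : R.LPFeasible γ y) {z : R.PrefixState} (hz : z ∈ R.inPrefix R.Xr) (z' : R.PrefixState) :
    (∑ u ∈ R.prefixEnabled z, y z u) * (R.prefixPolicy h0 hy).trans z z' ≤
      ∑ u ∈ R.prefixEnabled z, y z u * R.prefixP z u z' := by
  have hlp := R.mem_lpStates_of_mem_inPrefix hz
  -- With zero total weight the policy is uniform at `z`, but the left side vanishes. With positive
  -- weight the normalization cancels and equality holds.
  rcases (Finset.sum_nonneg (hy.nonneg z hlp)).eq_or_lt with h | h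
  · rw [← h, zero_mul]
    exact Finset.sum_nonneg fun u hu =>
      mul_nonneg (hy.nonneg z hlp u hu) ((R.prefixMDP h0).p_nonneg z u hu z')
  · refine le_of_eq ?_
    change _ * ∑ u ∈ R.prefixEnabled z, R.prefixPolicyProb y z u * R.prefixP z u z' = _
    rw [Finset.mul_sum]
    refine Finset.sum_congr rfl fun u hu => ?_
    rw [prefixPolicyProb, if_pos hu, if_pos ⟨hz, h⟩, ← mul_assoc, mul_div_cancel₀ _ h.ne']

/-- Under the prefix policy of a feasible `y`, the chain almost surely leaves `X_r`. -/
theorem ae_exists_notMem_Xr {γ : ℝ} {y : R.PrefixState → Option U → ℝ}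
    (hy : R.LPFeasible γ y) :
    ∀ᵐ ω ∂(R.prefixPolicy h0 hy).pathMeasure, ∃ n, ω n ∉ R.inPrefix R.Xr := by
  classical
  refine (R.prefixPolicy h0 hy).ae_exists_notMem _ ?_ (fun z => ∑ u ∈ R.prefixEnabled z, y z u)
    (fun z hz => Finset.sum_nonneg (hy.nonneg z (R.mem_lpStates_of_mem_inPrefix hz))) ?_
  · rintro z hz z' hz'
    refine R.trans_eq_zero_of_notMem_Xr h0 _ hz ?_
    rintro rfl
    exact R.trap_notMem_inPrefix _ hz'
  · intro z' hz'
    -- The flow constraint is the balance equation for the total weights. Its inflow runs over all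
    -- non-trap states; restricting to `X_r` drops only nonnegative terms.
    rw [hy.flow z' hz']
    refine add_le_add ?_ ?_
    · refine (Finset.sum_le_sum fun z hz =>
        R.mul_prefixPolicy_trans_le h0 hy (Finset.mem_filter.1 hz).2 z').trans ?_
      refine Finset.sum_le_sum_of_subset_of_nonneg
        (fun z hz => R.mem_lpStates_of_mem_inPrefix (Finset.mem_filter.1 hz).2) ?_
      exact fun z hz _ => Finset.sum_nonneg fun u hu =>
        mul_nonneg (hy.nonneg z hz u hu) ((R.prefixMDP h0).p_nonneg z u hu z')
    · by_cases h : z' = (R.prefixMDP h0).init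
      · rw [if_pos h, if_pos (by rw [h]; exact ⟨⟨R.init, h0⟩, rfl, rfl⟩)]
      · rw [if_neg h]
        split_ifs <;> norm_num

/-- Under the prefix policy of a feasible `y`, the chain almost surely enters an accepting maximal
end component and moves to the trap state afterwards. -/
theorem ae_exists_amecStates_and_trap {γ : ℝ} {y : R.PrefixState → Option U → ℝ}
    (hy : R.LPFeasible γ y) :
    ∀ᵐ ω ∂(R.prefixPolicy h0 hy).pathMeasure,
      ∃ n, ω n ∈ R.inPrefix R.amecStates ∧ ω (n + 1) = R.trap := by
  classical
  filter_upwards [(R.prefixPolicy h0 hy).ae_eval_zero, (R.prefixPolicy h0 hy).ae_trans_pos,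
    R.ae_exists_notMem_Xr h0 hy] with ω hinit hpos hex
  have hn := Nat.find_spec hex
  -- At the first exit time the path is not yet at the trap: at time 0 it is at the embedded initial
  -- state (the case of an initial state inside an AMEC), and later its predecessor is in `X_r`,
  -- from which the trap has probability 0.
  have htrap : ω (Nat.find hex) ≠ R.trap := by
    intro h
    rcases hk : Nat.find hex with _ | k
    · rw [hk, hinit] at h
      exact Option.some_ne_none _ h
    · have hXr : ω k ∈ R.inPrefix R.Xr := not_not.1 (Nat.find_min hex (by omega))
      have hp := hpos k
      rw [← hk, h, R.trans_trap_eq_zero h0 _ hXr] at hp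
      exact hp.false
  refine ⟨Nat.find hex, ?_, ?_⟩
  · obtain ⟨x, hx⟩ := Option.ne_none_iff_exists'.1 htrap
    refine ⟨x, hx, R.prefixCore_mem_amecStates x.2 fun h => hn ⟨x, hx, h⟩⟩
  · by_contra h
    exact (hpos (Nat.find hex)).ne' (R.trans_eq_zero_of_notMem_Xr h0 _ hn h)

end CostMDP

theorem mainTheorem2 {S A AP Q E : Type*}
    [Fintype S] [Fintype A] [Fintype AP] [Fintype Q] [Fintype E]
    (M : PLMDP S A AP) (B : LDBA AP Q E) (hB : B.Nonblocking)
    (R : CostMDP (ProdState M Q) (A × (Set AP ⊕ E))) (hR : R = relaxedProduct M B hB)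
    (β γ : ℝ) (hβ : 0 < β) (hγ0 : 0 < γ) (hγ1 : γ ≤ 1)
    (h0 : R.init ∈ R.prefixCore)
    (y : R.PrefixState → Option (A × (Set AP ⊕ E)) → ℝ) (hy : R.LPOptimal β γ y) :
    γ ≤ (R.prefixPolicy h0 hy.feasible).pathMeasure.real {ω | ∃ n, ω n = R.trap} ∧
    γ ≤ (R.prefixPolicy h0 hy.feasible).pathMeasure.real
      {ω | ∃ n, ω n ∈ R.inPrefix R.amecStates} := by
  have h := R.ae_exists_amecStates_and_trap h0 hy.feasible
  have hone : ∀ s : Set (ℕ → R.PrefixState),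
      (∀ᵐ ω ∂(R.prefixPolicy h0 hy.feasible).pathMeasure, ω ∈ s) →
        γ ≤ (R.prefixPolicy h0 hy.feasible).pathMeasure.real s := by
    intro s hs
    -- An almost sure event has measure 1, measurable or not, so the goal becomes `γ ≤ 1`.
    rwa [measureReal_def, show (R.prefixPolicy h0 hy.feasible).pathMeasure s = _ from
      measure_congr (Filter.eventuallyEq_univ.2 hs), measure_univ, ENNReal.toReal_one]
  refine ⟨hone _ ?_, hone _ ?_⟩
  · filter_upwards [h] with ω hω using hω.elim fun n hn => ⟨n + 1, hn.2⟩
  · filter_upwards [h] with ω hω using hω.elim fun n hn => ⟨n, hn.1⟩
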